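/- **Setting.** There are $n$ agents with signals $s_i\in[0,1]$, signal profiles $\mathbf s\in\mathcal S=[0,1]^n$, and a finite set $\mathcal A$ of alternatives. A valuation is a function $v:\mathcal A\times\mathcal S\to\mathbb R_{\ge 0}$ that is nondecreasing in each signal; for a lottery $\delta\in\Delta(\mathcal A)$ put $v(\delta;\mathbf s)=\sum_a\delta(a)v(a;\mathbf s)$. A social choice function is a map $f:\mathcal S\to\Delta(\mathcal A)$. For a profile $(v_1,\dots,v_n)$ of valuations: * $f$ satisfies *weak monotonicity* (W-Mon) if for all $\mathbf s\in\mathcal S$, all agents $i$ and all $s_i'\in[0,1]$, with $\delta=f(\mathbf s)$ and $\delta'=f(s_i',\mathbf s_{-i})$, $$v_i(\delta';s_i',\mathbf s_{-i})-v_i(\delta';\mathbf s)\ \ge\ v_i(\delta;s_i',\mathbf s_{-i})-v_i(\delta;\mathbf s).$$ * $f$ is *implementable* if there are payments $p_i:\mathcal S\to\mathbb R$ such that for all $\mathbf s$, $i$ and $b\in[0,1]$, $$v_i(f(\mathbf s);\mathbf s)-p_i(\mathbf s)\ \ge\ \max\{v_i(f(b,\mathbf s_{-i});\mathbf s)-p_i(b,\mathbf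 s_{-i}),\,0\}.$$ A valuation $v_i$ of agent $i$ is *decomposable* if $v_i(a;\mathbf s)=\hat v(\mathbf s)\,h(a;\mathbf s_{-i})+g(a;\mathbf s_{-i})$ for some $\hat v:\mathcal S\to\mathbb R_{\ge0}$, $h\ge 0$ and real-valued $g$. It is called *single-dimensional* if, up to a term common to all alternatives, it moves on a line for fixed $\mathbf s_{-i}$: $v_i(a;\mathbf s)=\lambda(\mathbf s)\,h(a;\mathbf s_{-i})+g(a;\mathbf s_{-i})+c(\mathbf s)$ for some real-valued functions $\lambda,h,g,c$. **Statement.** 1. Let $v$ be a valuation of agent $i$ that is non-decomposable and not single-dimensional. Then there is a social choice function $f:\mathcal S\to\Delta(\mathcal A)$ such that $f$ satisfies W-Mon whenever agent $i$ has valuation $v$ and no other agent's value depends on her own signal (in particular when $i$ is the only agent), and yet $f$ is not implementable, whatever the valuations of the other agents. 2. In contrast, if the valuations of all agents are decomposable, then every social choice function satisfies W-Mon if and only if it is implementable. Thus, single-dimensional valuations aside, decomposable valuations are the frontier for W-Mon characterizations of implementability. -/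

import Mathlib

namespace IDV

/-- Signal profiles `s = (s_1, …, s_n)`: every agent's signal space is `[0,1]`. -/
abbrev Profile (n : ℕ) : Type := Fin n → unitInterval

/-- Profiles `s_{-i}` of the signals of all the agents other than `i`. -/
abbrev Others {n : ℕ} (i : Fin n) : Type := {j : Fin n // j ≠ i} → unitInterval

/-- The profile `s_{-i}` obtained from `s` by dropping the signal of agent `i`. -/
def others {n : ℕ} (i : Fin n) (s : Profile n) : Others i := fun j => s j.1

/-- The profile `(b, s_{-i})`. -/
def deviate {n : ℕ} (s : Profile n) (i : Fin n) (b : unitInterval) : Profile n :=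
  Function.update s i b

/-- An interdependent valuation `v(a; s)` of one agent: nonnegative, and nondecreasing in the
signal of every agent (`Monotone` is with respect to the coordinatewise order on profiles). -/
def IsValuation {n : ℕ} {A : Type*} (v : A → Profile n → ℝ) : Prop :=
  (∀ a s, 0 ≤ v a s) ∧ ∀ a, Monotone (v a)

/-- The expected value `⟨v(s), δ⟩ = ∑ a, δ(a) v(a; s)` of a lottery `δ` over the alternatives. -/
def expVal {n : ℕ} {A : Type*} [Fintype A] (v : A → Profile n → ℝ) (s : Profile n)
    (δ : stdSimplex ℝ A) : ℝ :=
  ∑ a, δ.1 a * v a s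

/-- The valuation `v` of agent `i` is decomposable:
`v(a; s) = vhat(s) * h(a; s_{-i}) + g(a; s_{-i})` with `vhat, h ≥ 0`. -/
def Decomposable {n : ℕ} {A : Type*} (i : Fin n) (v : A → Profile n → ℝ) : Prop :=
  ∃ (vhat : Profile n → ℝ) (h g : A → Others i → ℝ),
    (∀ s, 0 ≤ vhat s) ∧ (∀ a t, 0 ≤ h a t) ∧
    ∀ a s, v a s = vhat s * h a (others i s) + g a (others i s)

/-- The valuation `v` of agent `i` is single-dimensional: for fixed signals of the others, the
vector of values of the alternatives moves along a single line, up to a term `c(s)` that is the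
same for all alternatives. -/
def SingleDimensional {n : ℕ} {A : Type*} (i : Fin n) (v : A → Profile n → ℝ) : Prop :=
  ∃ (lam c : Profile n → ℝ) (h g : A → Others i → ℝ),
    ∀ a s, v a s = lam s * h a (others i s) + g a (others i s) + c s

/-- The value of agent `j` does not depend on her own signal. -/
def OwnSignalIrrelevant {n : ℕ} {A : Type*} (j : Fin n) (v : A → Profile n → ℝ) : Prop :=
  ∀ a s b, v a (deviate s j b) = v a s

/-- Weak monotonicity of the (possibly randomized) social choice function `f`, for the
valuation profile `w`. -/
def WMon {n : ℕ} {A : Type*} [Fintype A] (w : Fin n → A → Profile n → ℝ)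
    (f : Profile n → stdSimplex ℝ A) : Prop :=
  ∀ (s : Profile n) (i : Fin n) (b : unitInterval),
    expVal (w i) (deviate s i b) (f s) - expVal (w i) s (f s) ≤
      expVal (w i) (deviate s i b) (f (deviate s i b)) - expVal (w i) s (f (deviate s i b))

/-- The mechanism `(f, p)` is ex-post incentive compatible and individually rational. -/
def ExPostICIR {n : ℕ} {A : Type*} [Fintype A] (w : Fin n → A → Profile n → ℝ)
    (f : Profile n → stdSimplex ℝ A) (p : Fin n → Profile n → ℝ) : Prop :=
  ∀ (s : Profile n) (i : Fin n) (b : unitInterval),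
    max (expVal (w i) s (f (deviate s i b)) - p i (deviate s i b)) 0 ≤
      expVal (w i) s (f s) - p i s

/-- The social choice function `f` is implementable for the valuation profile `w`. -/
def Implementable {n : ℕ} {A : Type*} [Fintype A] (w : Fin n → A → Profile n → ℝ)
    (f : Profile n → stdSimplex ℝ A) : Prop :=
  ∃ p : Fin n → Profile n → ℝ, ExPostICIR w f p

end IDV

/-! Fix `s_{-i}`. Implementability requires the IC inequalities to have nonnegative sums around
every cycle of reports; W-Mon only tests 2-cycles. For a decomposable valuation the type is
effectively the number `vhat`, and W-Mon says that the expected slope is nondecreasing in it.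
Integrating the slope gives a convex potential, used as the agent's utility
(`exists_nonneg_subgradient`). If the valuation is not single-dimensional, two value differences
trace a plane curve containing a nondegenerate triangle. Perturbing the uniform lottery along the
curve rotated by 90 degrees makes the interaction of type and report antisymmetric: W-Mon holds with
equality, while the sum around the triangle is a multiple of its signed area. -/

namespace IDV

open MeasureTheory

section Profiles

variable {n : ℕ}

/-- The profile `(b, t)` with signal `b` for agent `i` and signals `t` for the others. -/
def glue (i : Fin n) (t : Others i) (b : unitInterval) : Profile n :=
  fun j => if h : j = i then b else t ⟨j, h⟩

@[simp] lemma glue_self (i : Fin n) (t : Others i) (b : unitInterval) : glue i t b i = b := by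
  simp [glue]

@[simp] lemma others_glue (i : Fin n) (t : Others i) (b : unitInterval) :
    others i (glue i t b) = t := by
  funext j
  simp [others, glue, j.2]

@[simp] lemma glue_others (i : Fin n) (s : Profile n) : glue i (others i s) (s i) = s := by
  funext j
  by_cases h : j = i
  · subst h; simp
  · simp [glue, others, h]

@[simp] lemma deviate_self (s : Profile n) (i : Fin n) (b : unitInterval) :
    deviate s i b i = b := by
  simp [deviate]

@[simp] lemma others_deviate (s : Profile n) (i : Fin n) (b : unitInterval) :
    others i (deviate s i b) = others i s := by
  funext j
  simp [others, deviate, j.2]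

lemma deviate_glue (i : Fin n) (t : Others i) (b c : unitInterval) :
    deviate (glue i t b) i c = glue i t c := by
  have h := glue_others i (deviate (glue i t b) i c)
  rw [others_deviate, others_glue, deviate_self] at h
  exact h.symm

@[simp] lemma deviate_deviate_self (s : Profile n) (i : Fin n) (b : unitInterval) :
    deviate (deviate s i b) i (s i) = s := by
  simp [deviate]

lemma glue_mono (i : Fin n) (t : Others i) : Monotone (glue i t) := by
  intro b c h j
  by_cases hj : j = i
  · simp [glue, hj, h]
  · simp [glue, hj]

end Profiles

section Implementability

variable {n : ℕ} {A : Type*} [Fintype A]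

lemma Implementable.wMon {w : Fin n → A → Profile n → ℝ} {f : Profile n → stdSimplex ℝ A}
    (hf : Implementable w f) : WMon w f := by
  obtain ⟨p, hp⟩ := hf
  intro s i b
  have h1 := (le_max_left _ _).trans (hp s i b)
  have h2 := (le_max_left _ _).trans (hp (deviate s i b) i (s i))
  rw [deviate_deviate_self] at h2
  linarith

/-- A map with bounded nonnegative slopes that is monotone in a nonnegative parameter is a
selection of subgradients of a nonnegative function. -/
lemma exists_nonneg_subgradient {B : Type*} (θ H : B → ℝ) (C : ℝ) (hθ : ∀ b, 0 ≤ θ b)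
    (hH : ∀ b, 0 ≤ H b) (hC : ∀ b, H b ≤ C)
    (hmono : ∀ b c, 0 ≤ (θ c - θ b) * (H c - H b)) :
    ∃ U : ℝ → ℝ, (∀ b, 0 ≤ U (θ b)) ∧
      ∀ b c, U (θ b) + (θ c - θ b) * H b ≤ U (θ c) := by
  -- The extra `0` keeps the set nonempty when `x` lies below every `θ b`.
  let S : ℝ → Set ℝ := fun x => insert 0 (H '' {b | θ b ≤ x})
  let X : ℝ → ℝ := fun x => sSup (S x)
  have hbdd : ∀ x, BddAbove (S x) := by
    intro x
    refine ⟨max C 0, ?_⟩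
    rintro _ (rfl | ⟨b, -, rfl⟩)
    · exact le_max_right _ _
    · exact (hC b).trans (le_max_left _ _)
  have hXmono : Monotone X := by
    intro x y hxy
    refine csSup_le_csSup (hbdd y) ⟨0, Set.mem_insert _ _⟩ (Set.insert_subset_insert ?_)
    exact Set.image_mono fun b hb => le_trans hb hxy
  have hX0 : ∀ x, 0 ≤ X x := fun x => le_csSup (hbdd x) (Set.mem_insert _ _)
  have hXge : ∀ b x, θ b ≤ x → H b ≤ X x := fun b x hx =>
    le_csSup (hbdd x) (Set.mem_insert_of_mem _ ⟨b, hx, rfl⟩)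
  have hXle : ∀ b x, x < θ b → X x ≤ H b := by
    intro b x hx
    refine csSup_le ⟨0, Set.mem_insert _ _⟩ ?_
    rintro _ (rfl | ⟨c, hc, rfl⟩)
    · exact hH b
    · have hlt : 0 < θ b - θ c := sub_pos.2 (lt_of_le_of_lt hc hx)
      have := nonneg_of_mul_nonneg_right (hmono c b) hlt
      linarith
  have hint : ∀ x y, IntervalIntegrable X volume x y := fun x y => hXmono.intervalIntegrable
  -- Base point `0` and `θ ≥ 0` give `U ≥ 0`, hence individual rationality.
  refine ⟨fun x => ∫ y in (0 : ℝ)..x, X y, fun b => ?_, fun b c => ?_⟩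
  · exact intervalIntegral.integral_nonneg (hθ b) fun x _ => hX0 x
  · have hadd := intervalIntegral.integral_add_adjacent_intervals
      (hint 0 (θ b)) (hint (θ b) (θ c))
    suffices (θ c - θ b) * H b ≤ ∫ y in (θ b)..(θ c), X y by
      change (∫ y in (0 : ℝ)..(θ b), X y) + _ ≤ ∫ y in (0 : ℝ)..(θ c), X y
      linarith
    rcases le_total (θ b) (θ c) with h | h
    · have := intervalIntegral.integral_mono_on h intervalIntegrable_const (hint _ _)
        (fun x hx => hXge b x hx.1)
      simpa using this
    -- The open interval matters: at `x = θ b`, ties in `θ` can make `X x` exceed `H b`.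
    · have := intervalIntegral.integral_mono_on_of_le_Ioo h (hint (θ c) (θ b))
        intervalIntegrable_const (fun x hx => hXle b x hx.2)
      rw [intervalIntegral.integral_symm]
      simp only [intervalIntegral.integral_const, smul_eq_mul] at this
      linarith

lemma WMon.implementable {w : Fin n → A → Profile n → ℝ} (hw : ∀ j, Decomposable j (w j))
    {f : Profile n → stdSimplex ℝ A} (hf : WMon w f) : Implementable w f := by
  choose θ h g hθ hh hwd using hw
  let H : ∀ i : Fin n, Others i → Profile n → ℝ := fun i t s => ∑ a, (f s).1 a * h i a t
  have hval : ∀ i s r, others i s = others i r →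
      expVal (w i) s (f r) - expVal (w i) r (f r) = (θ i s - θ i r) * H i (others i r) r := by
    intro i s r hsr
    simp only [expVal, H, ← Finset.sum_sub_distrib, Finset.mul_sum]
    refine Finset.sum_congr rfl fun a _ => ?_
    rw [hwd i a s, hwd i a r, hsr]
    ring
  have key : ∀ (i : Fin n) (t : Others i), ∃ U : ℝ → ℝ,
      (∀ b, 0 ≤ U (θ i (glue i t b))) ∧
      ∀ b c, U (θ i (glue i t b)) +
        (θ i (glue i t c) - θ i (glue i t b)) * H i t (glue i t b) ≤ U (θ i (glue i t c)) := by
    intro i t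
    refine exists_nonneg_subgradient (fun b => θ i (glue i t b)) (fun b => H i t (glue i t b))
      (∑ a, h i a t) (fun b => hθ _ _) (fun b => ?_) (fun b => ?_) (fun b c => ?_)
    · exact Finset.sum_nonneg fun a _ => mul_nonneg ((f _).2.1 a) (hh _ _ _)
    · refine Finset.sum_le_sum fun a _ => mul_le_of_le_one_left (hh _ _ _) ?_
      rw [← (f (glue i t b)).2.2]
      exact Finset.single_le_sum (fun a _ => (f (glue i t b)).2.1 a) (Finset.mem_univ a)
    · have h1 := hf (glue i t b) i c
      rw [deviate_glue] at h1
      have h2 := hval i (glue i t c) (glue i t b) (by simp)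
      have h3 := hval i (glue i t b) (glue i t c) (by simp)
      rw [others_glue] at h2 h3
      linarith
  choose U hU0 hU using key
  -- The payment leaves the agent exactly the utility `U`, so IC is the subgradient inequality.
  refine ⟨fun i s => expVal (w i) s (f s) - U i (others i s) (θ i s), fun s i b => ?_⟩
  have h0 := hU0 i (others i s) (s i)
  have h1 := hU i (others i s) b (s i)
  have h2 := hval i s (deviate s i b) (by simp)
  have hd : glue i (others i s) b = deviate s i b := by
    conv_rhs => rw [← glue_others i s]
    rw [deviate_glue]
  rw [glue_others] at h0
  rw [glue_others, hd] at h1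
  rw [others_deviate] at h2
  simp only [others_deviate]
  refine max_le ?_ ?_ <;> linarith

end Implementability

section Frontier

variable {n : ℕ} {A : Type*}

/-- The function `u` of two variables is a product if its `2 × 2` minors vanish. -/
lemma exists_mul_of_minors_eq_zero {B : Type*} (u : A → B → ℝ)
    (hu : ∀ a a' b b', u a b * u a' b' = u a' b * u a b') :
    ∃ (h : A → ℝ) (l : B → ℝ), ∀ a b, u a b = l b * h a := by
  by_cases h0 : ∀ a b, u a b = 0
  · exact ⟨0, 0, by simpa using h0⟩
  · push Not at h0
    obtain ⟨a, b, hab⟩ := h0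
    refine ⟨fun a' => u a' b, fun b' => u a b' / u a b, fun a' b' => ?_⟩
    have := hu a a' b b'
    field_simp
    linarith

/-- A valuation that is not single-dimensional has, for some signals of the others, three own
signals at which the differences between three alternatives are affinely independent. -/
lemma exists_triangle_of_not_singleDimensional {i : Fin n} {v : A → Profile n → ℝ}
    (hv : ¬ SingleDimensional i v) :
    ∃ (t : Others i) (o a a' : A) (b b' : unitInterval),
      let y : A → unitInterval → ℝ := fun x c => v x (glue i t c) - v o (glue i t c)
      (y a b - y a 0) * (y a' b' - y a' 0) < (y a' b - y a' 0) * (y a b' - y a 0) := by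
  by_contra! hcon
  apply hv
  rcases isEmpty_or_nonempty A with hA | ⟨⟨o⟩⟩
  · exact ⟨0, 0, 0, 0, fun a => hA.elim a⟩
  have key : ∀ t : Others i, ∃ (h : A → ℝ) (l : unitInterval → ℝ), ∀ a b,
      v a (glue i t b) - v o (glue i t b) - (v a (glue i t 0) - v o (glue i t 0))
        = l b * h a := by
    intro t
    refine exists_mul_of_minors_eq_zero
      (fun a b => v a (glue i t b) - v o (glue i t b) - (v a (glue i t 0) - v o (glue i t 0)))
      fun a a' b b' => ?_
    -- Swapping `a` and `a'` flips the sign of the minor.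
    exact le_antisymm (not_lt.1 (hcon t o a' a b b')) (not_lt.1 (hcon t o a a' b b'))
  choose h l hl using key
  refine ⟨fun s => l (others i s) (s i),
    fun s => v o s - v o (glue i (others i s) 0), fun a t => h t a,
    fun a t => v a (glue i t 0), fun a s => ?_⟩
  have := hl (others i s) a (s i)
  rw [glue_others] at this
  linarith

variable [Fintype A]

/-- Uniform lottery perturbed along `y' (e_a - e_o) - y (e_a' - e_o)`. -/
lemma exists_rotated_lottery {B : Type*} (o a a' : A) (y y' : B → ℝ) (C : ℝ)
    (hy : ∀ b, |y b| ≤ C) (hy' : ∀ b, |y' b| ≤ C) :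
    ∃ ε > 0, ∃ f : B → stdSimplex ℝ A, ∀ b (x : A → ℝ),
      ∑ c, (f b).1 c * x c = (∑ c, x c) / Fintype.card A +
        ε * (y' b * (x a - x o) - y b * (x a' - x o)) := by
  classical
  have hN : (0 : ℝ) < Fintype.card A := Nat.cast_pos.2 (Fintype.card_pos_iff.2 ⟨o⟩)
  let N : ℝ := Fintype.card A
  -- The perturbation has size at most `2 * |C| / D`, less than the uniform weight `1 / N`.
  let D : ℝ := N * (4 * |C| + 1)
  have hD : 0 < D := by positivity
  let e : A → A → ℝ := fun c => Pi.single c 1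
  let F : B → A → ℝ := fun b c =>
    1 / N + 1 / D * (y' b * (e a c - e o c) - y b * (e a' c - e o c))
  have hF : ∀ b (x : A → ℝ), ∑ c, F b c * x c = (∑ c, x c) / N +
      1 / D * (y' b * (x a - x o) - y b * (x a' - x o)) := by
    intro b x
    have he : ∀ d, ∑ c, e d c * x c = x d := by
      intro d
      simp [e, Pi.single_apply]
    have hsplit : ∀ c, F b c * x c = 1 / N * x c + 1 / D * y' b * (e a c * x c)
        - 1 / D * y b * (e a' c * x c) - 1 / D * (y' b - y b) * (e o c * x c) := by
      intro c
      simp only [F]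
      ring
    simp only [hsplit, Finset.sum_sub_distrib, Finset.sum_add_distrib, ← Finset.mul_sum, he]
    ring
  have he01 : ∀ d c, 0 ≤ e d c ∧ e d c ≤ 1 := by
    intro d c
    simp only [e, Pi.single_apply]
    split_ifs <;> simp
  have habs : ∀ d c, |e d c - e o c| ≤ 1 := fun d c => by
    have h1 := he01 d c
    have h2 := he01 o c
    rw [abs_le]
    constructor <;> linarith [h1.1, h1.2, h2.1, h2.2]
  have hnonneg : ∀ b c, 0 ≤ F b c := by
    intro b c
    have hb : ∀ (z : ℝ) (d : A), |z| ≤ C → |z * (e d c - e o c)| ≤ |C| := by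
      intro z d hz
      rw [abs_mul]
      exact (mul_le_of_le_one_right (abs_nonneg _) (habs d c)).trans (hz.trans (le_abs_self C))
    have h1 := abs_le.1 (hb (y' b) a (hy' b))
    have h2 := abs_le.1 (hb (y b) a' (hy b))
    have hFb : F b c = 1 / D *
        (4 * |C| + 1 + (y' b * (e a c - e o c) - y b * (e a' c - e o c))) := by
      simp only [F, D]
      have : N ≠ 0 := hN.ne'
      field_simp
    rw [hFb]
    refine mul_nonneg (by positivity) ?_
    linarith [abs_nonneg C, h1.1, h2.2]
  refine ⟨1 / D, by positivity, fun b => ⟨F b, hnonneg b, ?_⟩, hF⟩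
  have := hF b 1
  simp only [Pi.one_apply, mul_one, sub_self, mul_zero, add_zero, Finset.sum_const,
    Finset.card_univ, nsmul_eq_mul] at this
  rw [this]
  exact div_self hN.ne'

/-- If agent `i` is not single-dimensional, then some social choice function satisfies weak
monotonicity with equality but is not implementable. -/
lemma exists_wMon_not_implementable {i : Fin n} {v : A → Profile n → ℝ} (hv : IsValuation v)
    (hsd : ¬ SingleDimensional i v) :
    ∃ f : Profile n → stdSimplex ℝ A,
      (∀ w : Fin n → A → Profile n → ℝ, w i = v →
        (∀ j, j ≠ i → OwnSignalIrrelevant j (w j)) → WMon w f) ∧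
      ∀ w : Fin n → A → Profile n → ℝ, w i = v → ¬ Implementable w f := by
  classical
  obtain ⟨t, o, a, a', b, b', hdet⟩ := exists_triangle_of_not_singleDimensional hsd
  let y : A → unitInterval → ℝ := fun x c => v x (glue i t c) - v o (glue i t c)
  have hvle : ∀ x c, v x (glue i t c) ≤ ∑ x, v x (glue i t 1) := fun x c =>
    (hv.2 x (glue_mono i t unitInterval.le_one')).trans
      (Finset.single_le_sum (fun x _ => hv.1 x (glue i t 1)) (Finset.mem_univ x))
  have hy : ∀ x c, |y x c| ≤ ∑ x, v x (glue i t 1) := fun x c => by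
    have h1 := hv.1 x (glue i t c)
    have h2 := hv.1 o (glue i t c)
    have h3 := hvle x c
    have h4 := hvle o c
    rw [abs_le]
    constructor <;> simp only [y] <;> linarith
  obtain ⟨ε, hε, F, hF⟩ := exists_rotated_lottery o a a' (y a) (y a') _ (hy a) (hy a')
  let f : Profile n → stdSimplex ℝ A := fun s => if others i s = t then F (s i) else F 0
  have hfg : ∀ c, f (glue i t c) = F c := fun c => by simp [f]
  have hE : ∀ c d, expVal v (glue i t c) (F d) = (∑ x, v x (glue i t c)) / Fintype.card A +
      ε * (y a' d * y a c - y a d * y a' c) := fun c d =>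
    hF d fun x => v x (glue i t c)
  refine ⟨f, ?_, ?_⟩
  · intro w hwi hw s j c
    by_cases hj : j = i
    · subst hj
      rw [hwi]
      -- Off the slice `t`, `f` ignores the signal of agent `i`.
      by_cases hs : others j s = t
      · obtain ⟨d, rfl⟩ : ∃ d, s = glue j t d := ⟨s j, by rw [← hs, glue_others]⟩
        rw [deviate_glue, hfg, hfg, hE, hE, hE, hE]
        apply le_of_eq
        ring
      · simp [f, hs]
    · have hex : ∀ δ, expVal (w j) (deviate s j c) δ = expVal (w j) s δ := fun δ => by
        simp only [expVal, hw j hj _ s c]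
      simp [hex]
  · rintro w hwi ⟨p, hp⟩
    have hic : ∀ c d, expVal v (glue i t c) (F d) - p i (glue i t d) ≤
        expVal v (glue i t c) (F c) - p i (glue i t c) := by
      intro c d
      have := (le_max_left _ _).trans (hp (glue i t c) i d)
      rwa [deviate_glue, hfg, hfg, hwi] at this
    -- Around the cycle `0, b', b` the payments and diagonal values cancel, leaving `ε` times a
    -- determinant that should be nonpositive.
    have h1 := hic 0 b'
    have h2 := hic b' b
    have h3 := hic b 0
    rw [hE, hE] at h1 h2 h3
    have hpos := mul_pos hε (sub_pos.2 hdet)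
    change 0 < ε * ((y a' b - y a' 0) * (y a b' - y a 0)
      - (y a b - y a 0) * (y a' b' - y a' 0)) at hpos
    linarith

end Frontier

end IDV

theorem mainTheorem7 (n : ℕ) {A : Type*} [Fintype A] :
    (∀ (i : Fin n) (v : A → IDV.Profile n → ℝ), IDV.IsValuation v →
      ¬ IDV.Decomposable i v → ¬ IDV.SingleDimensional i v →
      ∃ f : IDV.Profile n → stdSimplex ℝ A,
        (∀ w : Fin n → A → IDV.Profile n → ℝ, w i = v →
          (∀ j, j ≠ i → IDV.OwnSignalIrrelevant j (w j)) → IDV.WMon w f) ∧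
        (∀ w : Fin n → A → IDV.Profile n → ℝ, w i = v → ¬ IDV.Implementable w f)) ∧
    (∀ w : Fin n → A → IDV.Profile n → ℝ,
      (∀ j, IDV.IsValuation (w j)) → (∀ j, IDV.Decomposable j (w j)) →
      ∀ f : IDV.Profile n → stdSimplex ℝ A, IDV.WMon w f ↔ IDV.Implementable w f) :=
  ⟨fun _ _ hv _ hsd => IDV.exists_wMon_not_implementable hv hsd,
    fun _ _ hw _ => ⟨IDV.WMon.implementable hw, IDV.Implementable.wMon⟩⟩
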